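/- Let $\mathbb K$ be a field, and let $P=(P(k,l))_{k,l\ge 0}$ be a TraP over $\mathbb K$. For $k,l,m\ge 0$, $p\in P(k,l)$ and $q\in P(l,m)$ put $$q\circ p \;=\; t_{k+1,1}\circ t_{k+2,2}\circ\cdots\circ t_{k+l,l}(p*q)\ \in P(k,m)$$ (so $q\circ p=p*q$ if $l=0$). Then $P$, with its actions of the symmetric groups, its horizontal concatenation $*$ and its unit $I_0$, and with the vertical concatenation $\circ$ and the unit $I_1:=I$ of the TraP, is a ProP. **Conventions.** $[n]=\{1,\dots,n\}$, and permutations are multiplied as maps. For $\sigma\in\mathfrak S_m$, $\sigma'\in\mathfrak S_n$, $\sigma\otimes\sigma'\in\mathfrak S_{m+n}$ acts as $\sigma$ on the first $m$ integers and as $\sigma'$ (shifted by $m$) on the last $n$; $c_{m,n}\in\mathfrak S_{m+n}$ is given by $c_{m,n}(i)=i+n$ if $i\le m$ and $c_{m,n}(i)=i-m$ if $i>m$. For $\alpha\in\mathfrak S_n$ and $a\in[n]$, $\alpha_a\in\mathfrak S_{n-1}$ is the permutation whose word is obtained from $\alpha(1)\dots\alpha(n)$ by deleting the letter $a$ and lowering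 by $1$ all letters greater than $a$. $(a,a+1,\dots,b)$ denotes the cycle $a\mapsto a+1\mapsto\cdots\mapsto b\mapsto a$. Both structures consist of $\mathbb K$-vector spaces $P(k,l)$ for $k,l\ge0$, with commuting linear actions of $\mathfrak S_l$ on the left and of $\mathfrak S_k$ on the right, bilinear maps $*:P(k,l)\times P(k',l')\to P(k+k',l+l')$ and an element $I_0\in P(0,0)$ such that, for all elements $p\in P(k,l)$, $p'\in P(k',l')$, $p''$ and all permutations of the appropriate degrees: * $(p*p')*p''=p*(p'*p'')$ and $I_0*p=p*I_0=p$; * $(\sigma\cdot p\cdot\tau)*(\sigma'\cdot p'\cdot\tau')=(\sigma\otimes\sigma')\cdot(p*p')\cdot(\tau\otimes\tau')$; * $c_{l,l'}\cdot(p*p')=(p'*p)\cdot c_{k,k'}$. **TraP.** A TraP has moreover linear partial traces $t_{i,j}:P(k,l)\to P(k-1,l-1)$ for $k,l\ge1$, $i\in[k]$, $j\in[l]$, and an element $I\in P(1,1)$, such that: * for $k,l\ge2$, $i\in[k]$, $j\in[l]$, $i'\in[k-1]$, $j'\in[l-1]$, one has $t_{i',j'}\circ t_{i,j}=t_{\bar\imath,\bar\jmath}\circ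 t_{\hat\imath,\hat\jmath}$, where $(\bar\imath,\hat\imath)=(i-1,i')$ if $i'<i$ and $(i,i'+1)$ if $i'\ge i$, and $(\bar\jmath,\hat\jmath)=(j-1,j')$ if $j'<j$ and $(j,j'+1)$ if $j'\ge j$; * $t_{i,j}(\sigma\cdot p\cdot\tau)=\sigma_j\cdot t_{\tau(i),\sigma^{-1}(j)}(p)\cdot\tau_{\tau(i)}$; * for all $k,l,k',l'\ge0$, $p\in P(k,l)$, $p'\in P(k',l')$, $i\in[k+k']$, $j\in[l+l']$: $t_{i,j}(p*p')=t_{i,j}(p)*p'$ if $i\le k$ and $j\le l$, and $t_{i,j}(p*p')=p*t_{i-k,j-l}(p')$ if $i>k$ and $j>l$; * for all $k,l\ge0$, $p\in P(k,l)$, $i\in[k+1]$, $j\in[l+1]$: $t_{1,j}(I*p)=(1,2,\dots,j-1)\cdot p$ if $j\ge2$; $t_{i,1}(I*p)=p\cdot(1,2,\dots,i-1)^{-1}$ if $i\ge2$; $t_{k+1,j}(p*I)=(j,j+1,\dots,l)^{-1}\cdot p$ if $j\le l$; $t_{i,l+1}(p*I)=p\cdot(i,i+1,\dots,k)$ if $i\le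 k$. **ProP.** A ProP has moreover bilinear maps $\circ:P(l,m)\times P(k,l)\to P(k,m)$ and an element $I_1\in P(1,1)$ such that, with $I_n=I_1^{*n}$ and $I_1^{*0}=I_0$, whenever the expressions make sense: * $p\circ(q\circ r)=(p\circ q)\circ r$, and $p\circ I_k=I_l\circ p=p$ for $p\in P(k,l)$; * $(p*p')\circ(q*q')=(p\circ q)*(p'\circ q')$; * $\sigma\cdot(p\circ q)=(\sigma\cdot p)\circ q$, $(p\circ q)\cdot\nu=p\circ(q\cdot\nu)$, and $(p\cdot\tau)\circ q=p\circ(\tau\cdot q)$. -/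

import Mathlib

/-! ## Permutations

All index sets `[n] = {1, …, n}` are modelled by `Fin n = {0, …, n - 1}`, so every index is shifted
by one.  Permutations are multiplied as functions: `(σ * τ) i = σ (τ i)`. -/

/-- `σ ⊗ σ'`: acts as `σ` on the first `m` indices and as `σ'` on the last `n` ones. -/
def permTensor {m n : ℕ} (σ : Equiv.Perm (Fin m)) (σ' : Equiv.Perm (Fin n)) :
    Equiv.Perm (Fin (m + n)) :=
  finSumFinEquiv.permCongr (Equiv.Perm.sumCongr σ σ')

/-- The block permutation `c_{m,n}`: the first `m` indices are shifted up by `n`, the last `n`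
indices are shifted down by `m`. -/
def blockSwap (m n : ℕ) : Equiv.Perm (Fin (m + n)) :=
  finAddFlip.trans (finCongr (Nat.add_comm n m))

/-- The permutation `α_a`, whose word is obtained from the word `α 1 … α n` of `α` by deleting the
letter `a` and decreasing by one all the letters greater than `a`. -/
def deleteLetter {n : ℕ} (α : Equiv.Perm (Fin (n + 1))) (a : Fin (n + 1)) : Equiv.Perm (Fin n) :=
  ((finSuccAboveEquiv (α.symm a)).trans
    (α.subtypeEquiv fun x => by rw [Ne, Ne, Equiv.eq_symm_apply])).trans
    (finSuccAboveEquiv a).symm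

/-- `α_a` is `α`, restricted to the complement of the position `α⁻¹ a` of `a`, with source and
target renumbered increasingly. -/
theorem succAbove_deleteLetter {n : ℕ} (α : Equiv.Perm (Fin (n + 1))) (a : Fin (n + 1))
    (m : Fin n) :
    a.succAbove (deleteLetter α a m) = α ((α.symm a).succAbove m) := by
  have h := finSuccAboveEquiv_apply a (deleteLetter α a m)
  simp only [deleteLetter, Equiv.trans_apply, Equiv.apply_symm_apply] at h
  simpa [finSuccAboveEquiv_apply, deleteLetter] using (congrArg Subtype.val h).symm

theorem permTensor_castAdd {m n : ℕ} (σ : Equiv.Perm (Fin m)) (σ' : Equiv.Perm (Fin n))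
    (i : Fin m) : permTensor σ σ' (Fin.castAdd n i) = Fin.castAdd n (σ i) := by
  simp [permTensor, Equiv.permCongr_apply]

theorem permTensor_natAdd {m n : ℕ} (σ : Equiv.Perm (Fin m)) (σ' : Equiv.Perm (Fin n))
    (i : Fin n) : permTensor σ σ' (Fin.natAdd m i) = Fin.natAdd m (σ' i) := by
  simp [permTensor, Equiv.permCongr_apply]

/-! ## Families of bimodules over the symmetric groups -/

universe u v

/-- A family of vector spaces `P(k,l)` (`k` entries, `l` exits) such that `P(k,l)` has commuting
linear actions, of `𝔖_l` on the left (`lact σ p` is `σ · p`) and of `𝔖_k` on the right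
(`ract τ p` is `p · τ`). -/
structure SymmModule (K : Type u) [Field K] where
  carrier : ℕ → ℕ → Type v
  [addCommGroup : ∀ k l, AddCommGroup (carrier k l)]
  [module : ∀ k l, Module K (carrier k l)]
  lact : ∀ {k l : ℕ}, Equiv.Perm (Fin l) → (carrier k l →ₗ[K] carrier k l)
  ract : ∀ {k l : ℕ}, Equiv.Perm (Fin k) → (carrier k l →ₗ[K] carrier k l)
  one_lact : ∀ {k l : ℕ} (p : carrier k l), lact 1 p = p
  one_ract : ∀ {k l : ℕ} (p : carrier k l), ract 1 p = p
  mul_lact : ∀ {k l : ℕ} (σ σ' : Equiv.Perm (Fin l)) (p : carrier k l),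
    lact (σ * σ') p = lact σ (lact σ' p)
  mul_ract : ∀ {k l : ℕ} (τ τ' : Equiv.Perm (Fin k)) (p : carrier k l),
    ract (τ * τ') p = ract τ' (ract τ p)
  lact_ract : ∀ {k l : ℕ} (σ : Equiv.Perm (Fin l)) (τ : Equiv.Perm (Fin k)) (p : carrier k l),
    lact σ (ract τ p) = ract τ (lact σ p)

attribute [instance] SymmModule.addCommGroup SymmModule.module

/-- The identity map `P(k,l) → P(k',l')` when `k = k'` and `l = l'`; it is needed only because
equalities such as `(a + b) + c = a + (b + c)` are not definitional. -/
def SymmModule.cast {K : Type u} [Field K] (P : SymmModule.{u, v} K) {k k' l l' : ℕ} :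
    k = k' → l = l' → (P.carrier k l →ₗ[K] P.carrier k' l')
  | rfl, rfl => LinearMap.id

@[simp]
theorem SymmModule.cast_rfl {K : Type u} [Field K] (P : SymmModule.{u, v} K) {k l : ℕ}
    (hk : k = k) (hl : l = l) (p : P.carrier k l) : P.cast hk hl p = p := rfl

/-- A family of bimodules over the symmetric groups with bilinear maps
`P(k,l) × P(k',l') → P(k+k',l+l')`, written `p * p'` in the comments, and an element `I₀` of
`P(0,0)`.  No law is imposed on them here. -/
structure ConcatModule (K : Type u) [Field K] extends SymmModule.{u, v} K where
  hmul : ∀ {k l k' l' : ℕ},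
    carrier k l →ₗ[K] carrier k' l' →ₗ[K] carrier (k + k') (l + l')
  unit₀ : carrier 0 0

/-- For `x ∈ P(1,1)`, the horizontal power `x^{*n} ∈ P(n,n)`, with `x^{*0} = I₀`. -/
def ConcatModule.hpow {K : Type u} [Field K] (P : ConcatModule.{u, v} K) (x : P.carrier 1 1) :
    ∀ n : ℕ, P.carrier n n
  | 0 => P.unit₀
  | n + 1 => P.hmul (P.hpow x n) x

/-! ## TraPs -/

/-- A TraP (Traces and Permutations). -/
structure TraP (K : Type u) [Field K] extends ConcatModule.{u, v} K where
  /-- Associativity of the horizontal concatenation. -/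
  hmul_assoc : ∀ {k l k' l' k'' l'' : ℕ} (p : carrier k l) (p' : carrier k' l')
    (p'' : carrier k'' l''),
    toSymmModule.cast (Nat.add_assoc k k' k'') (Nat.add_assoc l l' l'') (hmul (hmul p p') p'') =
      hmul p (hmul p' p'')
  /-- `I₀ * p = p`. -/
  unit₀_hmul : ∀ {k l : ℕ} (p : carrier k l),
    toSymmModule.cast (Nat.zero_add k) (Nat.zero_add l) (hmul unit₀ p) = p
  /-- `p * I₀ = p`. -/
  hmul_unit₀ : ∀ {k l : ℕ} (p : carrier k l), hmul p unit₀ = p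
  /-- `(σ · p · τ) * (σ' · p' · τ') = (σ ⊗ σ') · (p * p') · (τ ⊗ τ')`. -/
  hmul_act : ∀ {k l k' l' : ℕ} (σ : Equiv.Perm (Fin l)) (τ : Equiv.Perm (Fin k))
    (σ' : Equiv.Perm (Fin l')) (τ' : Equiv.Perm (Fin k')) (p : carrier k l) (p' : carrier k' l'),
    hmul (ract τ (lact σ p)) (ract τ' (lact σ' p')) =
      ract (permTensor τ τ') (lact (permTensor σ σ') (hmul p p'))
  /-- `c_{l,l'} · (p * p') = (p' * p) · c_{k,k'}`. -/
  hmul_comm : ∀ {k l k' l' : ℕ} (p : carrier k l) (p' : carrier k' l'),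
    lact (blockSwap l l') (hmul p p') =
      ract (blockSwap k k')
        (toSymmModule.cast (Nat.add_comm k' k) (Nat.add_comm l' l) (hmul p' p))
  /-- The partial trace `t_{i,j}`, which connects the exit `j` to the entry `i`. -/
  tr : ∀ {k l : ℕ}, Fin (k + 1) → Fin (l + 1) → (carrier (k + 1) (l + 1) →ₗ[K] carrier k l)
  /-- Commutativity of the partial traces.  Here `i.succAbove i'` is `i'` if `i' < i` and `i' + 1`
  otherwise, and `i'.predAbove i` is `i - 1` if `i' < i` and `i` otherwise. -/
  tr_tr : ∀ {k l : ℕ} (i : Fin (k + 2)) (j : Fin (l + 2)) (i' : Fin (k + 1)) (j' : Fin (l + 1))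
    (p : carrier (k + 2) (l + 2)),
    tr i' j' (tr i j p) =
      tr (i'.predAbove i) (j'.predAbove j) (tr (i.succAbove i') (j.succAbove j') p)
  /-- Compatibility of the partial traces with the actions: the letter `j` is deleted from `σ`, and
  the letter `τ i` (that is, the one at position `i`) from `τ`. -/
  tr_act : ∀ {k l : ℕ} (i : Fin (k + 1)) (j : Fin (l + 1)) (σ : Equiv.Perm (Fin (l + 1)))
    (τ : Equiv.Perm (Fin (k + 1))) (p : carrier (k + 1) (l + 1)),
    tr i j (ract τ (lact σ p)) =
      ract (deleteLetter τ (τ i)) (lact (deleteLetter σ j) (tr (τ i) (σ⁻¹ j) p))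
  /-- `t_{i,j} (p * p') = t_{i,j} p * p'` if the entry `i` and the exit `j` belong to `p`. -/
  tr_hmul_left : ∀ {k l k' l' : ℕ} (i : Fin (k + 1)) (j : Fin (l + 1))
    (p : carrier (k + 1) (l + 1)) (p' : carrier k' l'),
    tr (Fin.castLE (by omega) i : Fin (k + k' + 1)) (Fin.castLE (by omega) j : Fin (l + l' + 1))
        (toSymmModule.cast (Nat.add_right_comm k 1 k') (Nat.add_right_comm l 1 l') (hmul p p')) =
      hmul (tr i j p) p'
  /-- `t_{i,j} (p * p') = p * t_{i-k,j-l} p'` if the entry `i` and the exit `j` belong to `p'`. -/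
  tr_hmul_right : ∀ {k l k' l' : ℕ} (i : Fin (k' + 1)) (j : Fin (l' + 1))
    (p : carrier k l) (p' : carrier (k' + 1) (l' + 1)),
    tr (Fin.natAdd k i : Fin (k + k' + 1)) (Fin.natAdd l j : Fin (l + l' + 1)) (hmul p p') =
      hmul p (tr i j p')
  /-- The unit `I ∈ P(1,1)`. -/
  unit₁ : carrier 1 1
  /-- `t_{1,j+1} (I * p) = (1,2,…,j) · p` for `1 ≤ j ≤ l`. -/
  tr_unit₁_hmul_exit : ∀ {k l : ℕ} (j : Fin (l + 1)) (p : carrier k (l + 1)),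
    tr 0 j.succ (toSymmModule.cast (Nat.add_comm 1 k) (Nat.add_comm 1 (l + 1)) (hmul unit₁ p)) =
      lact (Fin.cycleIcc 0 j) p
  /-- `t_{i+1,1} (I * p) = p · (1,2,…,i)⁻¹` for `1 ≤ i ≤ k`. -/
  tr_unit₁_hmul_entry : ∀ {k l : ℕ} (i : Fin (k + 1)) (p : carrier (k + 1) l),
    tr i.succ 0 (toSymmModule.cast (Nat.add_comm 1 (k + 1)) (Nat.add_comm 1 l) (hmul unit₁ p)) =
      ract (Fin.cycleIcc 0 i)⁻¹ p
  /-- `t_{k+1,j} (p * I) = (j,j+1,…,l)⁻¹ · p` for `1 ≤ j ≤ l`. -/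
  tr_hmul_unit₁_exit : ∀ {k l : ℕ} (j : Fin (l + 1)) (p : carrier k (l + 1)),
    tr (Fin.last k) j.castSucc (hmul p unit₁) = lact (Fin.cycleIcc j (Fin.last l))⁻¹ p
  /-- `t_{i,l+1} (p * I) = p · (i,i+1,…,k)` for `1 ≤ i ≤ k`. -/
  tr_hmul_unit₁_entry : ∀ {k l : ℕ} (i : Fin (k + 1)) (p : carrier (k + 1) l),
    tr i.castSucc (Fin.last l) (hmul p unit₁) = ract (Fin.cycleIcc i (Fin.last k)) p

/-- The iterated partial trace `t_{k+1,1} ∘ … ∘ t_{k+l-1,l-1} ∘ t_{k+l,l}`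
from `P(k+l,l+m)` to `P(k,m)`. -/
def TraP.iterTr {K : Type u} [Field K] (P : TraP.{u, v} K) (k m : ℕ) :
    ∀ l : ℕ, P.carrier (k + l) (l + m) →ₗ[K] P.carrier k m
  | 0 => P.cast (Nat.add_zero k) (Nat.zero_add m)
  | l + 1 =>
    P.iterTr k m l ∘ₗ
      P.tr (Fin.last (k + l)) ⟨l, by omega⟩ ∘ₗ
      P.cast (Nat.add_assoc k l 1).symm (Nat.add_right_comm l 1 m)

/-- The vertical composition `q ∘ p = (t_{k+1,1} ∘ … ∘ t_{k+l,l}) (p * q) ∈ P(k,m)` of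
`q ∈ P(l,m)` and `p ∈ P(k,l)`. -/
def TraP.vcomp {K : Type u} [Field K] (P : TraP.{u, v} K) {k l m : ℕ} :
    P.carrier l m →ₗ[K] P.carrier k l →ₗ[K] P.carrier k m :=
  P.hmul.flip.compr₂ (P.iterTr k m l)

theorem TraP.vcomp_apply {K : Type u} [Field K] (P : TraP.{u, v} K) {k l m : ℕ}
    (q : P.carrier l m) (p : P.carrier k l) :
    P.vcomp q p = P.iterTr k m l (P.hmul p q) := rfl

/-! ## ProPs -/

/-- The family `P` of bimodules over the symmetric groups, with its horizontal concatenation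
`hmul` and its element `unit₀`, is a ProP with vertical concatenation `comp` (`comp p q` is
`p ∘ q`) and with unit `unit₁` in `P(1,1)`. -/
structure IsProP {K : Type u} [Field K] (P : ConcatModule.{u, v} K)
    (comp : ∀ {k l m : ℕ}, P.carrier l m →ₗ[K] P.carrier k l →ₗ[K] P.carrier k m)
    (unit₁ : P.carrier 1 1) : Prop where
  /-- Associativity of the horizontal concatenation. -/
  hmul_assoc : ∀ {k l k' l' k'' l'' : ℕ} (p : P.carrier k l) (p' : P.carrier k' l')
    (p'' : P.carrier k'' l''),
    P.cast (Nat.add_assoc k k' k'') (Nat.add_assoc l l' l'') (P.hmul (P.hmul p p') p'') =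
      P.hmul p (P.hmul p' p'')
  /-- `I₀ * p = p`. -/
  unit₀_hmul : ∀ {k l : ℕ} (p : P.carrier k l),
    P.cast (Nat.zero_add k) (Nat.zero_add l) (P.hmul P.unit₀ p) = p
  /-- `p * I₀ = p`. -/
  hmul_unit₀ : ∀ {k l : ℕ} (p : P.carrier k l), P.hmul p P.unit₀ = p
  /-- Associativity of the vertical concatenation. -/
  comp_assoc : ∀ {k l m n : ℕ} (p : P.carrier m n) (q : P.carrier l m) (r : P.carrier k l),
    comp p (comp q r) = comp (comp p q) r
  /-- `p ∘ I_k = p`, where `I_k` is the horizontal power `I₁^{*k}`. -/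
  comp_unit : ∀ {k l : ℕ} (p : P.carrier k l), comp p (P.hpow unit₁ k) = p
  /-- `I_l ∘ p = p`. -/
  unit_comp : ∀ {k l : ℕ} (p : P.carrier k l), comp (P.hpow unit₁ l) p = p
  /-- `(p * p') ∘ (q * q') = (p ∘ q) * (p' ∘ q')`. -/
  interchange : ∀ {k k' l l' m m' : ℕ} (p : P.carrier l m) (p' : P.carrier l' m')
    (q : P.carrier k l) (q' : P.carrier k' l'),
    comp (P.hmul p p') (P.hmul q q') = P.hmul (comp p q) (comp p' q')
  /-- `σ · (p ∘ q) = (σ · p) ∘ q`. -/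
  lact_comp : ∀ {k l m : ℕ} (σ : Equiv.Perm (Fin m)) (p : P.carrier l m) (q : P.carrier k l),
    P.lact σ (comp p q) = comp (P.lact σ p) q
  /-- `(p ∘ q) · ν = p ∘ (q · ν)`. -/
  ract_comp : ∀ {k l m : ℕ} (ν : Equiv.Perm (Fin k)) (p : P.carrier l m) (q : P.carrier k l),
    P.ract ν (comp p q) = comp p (P.ract ν q)
  /-- `(p · τ) ∘ q = p ∘ (τ · q)`. -/
  comp_balanced : ∀ {k l m : ℕ} (τ : Equiv.Perm (Fin l)) (p : P.carrier l m) (q : P.carrier k l),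
    comp (P.ract τ p) q = comp p (P.lact τ q)
  /-- `(σ · p) * (σ' · p') = (σ ⊗ σ') · (p * p')`. -/
  hmul_lact : ∀ {k l k' l' : ℕ} (σ : Equiv.Perm (Fin l)) (σ' : Equiv.Perm (Fin l'))
    (p : P.carrier k l) (p' : P.carrier k' l'),
    P.hmul (P.lact σ p) (P.lact σ' p') = P.lact (permTensor σ σ') (P.hmul p p')
  /-- `(p · τ) * (p' · τ') = (p * p') · (τ ⊗ τ')`. -/
  hmul_ract : ∀ {k l k' l' : ℕ} (τ : Equiv.Perm (Fin k)) (τ' : Equiv.Perm (Fin k'))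
    (p : P.carrier k l) (p' : P.carrier k' l'),
    P.hmul (P.ract τ p) (P.ract τ' p') = P.ract (permTensor τ τ') (P.hmul p p')
  /-- `c_{l,l'} · (p * p') = (p' * p) · c_{k,k'}`. -/
  hmul_comm : ∀ {k l k' l' : ℕ} (p : P.carrier k l) (p' : P.carrier k' l'),
    P.lact (blockSwap l l') (P.hmul p p') =
      P.ract (blockSwap k k')
        (P.cast (Nat.add_comm k' k) (Nat.add_comm l' l) (P.hmul p' p))

/-! Think of an element of `P(k,l)` as a box with labelled inputs and outputs. Composing vertically
means putting two boxes side by side and wiring the outputs of one to the inputs of the other, so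
each ProP law says that two wirings of the same boxes agree.

To avoid index arithmetic, entries and exits are labelled by arbitrary numbered finite types instead
of initial segments. Actions of permutations and casts then become one operation, renaming along
bijections. The axioms on partial traces reduce to: a trace commutes with renaming of the free
labels (`trace_relabel`), is unchanged when the traced labels are renamed simultaneously on both
sides (`trace_slide`), turns disjoint unions into iterated traces (`trace_sum`), commutes with
another trace (`trace_trace`), and can be pulled out of a product (`mul_trace`, `trace_mul`). The
delicate one is `trace_slide`: it rests on invariance under adjacent transpositions (`trFin_perm`).

Given these, associativity and interchange follow by pulling all traces outside. Both sides become
iterated traces of one product, and it remains to compare two bijections of entries and two of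
exits, which is checked pointwise on sum types. The horizontal powers of `I` are units because the
property `Yanks` is stable under products. Finally `vcomp_eq_comp` identifies the labelled
composition with the given one. -/

/-- A type with a chosen numbering of its elements by some `Fin n`. -/
class FinCoded (A : Type) where
  size : ℕ
  code : A ≃ Fin size

/-! ### Numbered types and the induced bijections of numbers. -/

namespace FinCoded

instance (n : ℕ) : FinCoded (Fin n) := ⟨n, Equiv.refl _⟩

instance {A B : Type} [FinCoded A] [FinCoded B] : FinCoded (A ⊕ B) :=
  ⟨size A + size B, (Equiv.sumCongr code code).trans finSumFinEquiv⟩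

/-- A bijection between two numbered types, as a bijection between their sets of numbers. -/
def transport {A A' : Type} [FinCoded A] [FinCoded A'] (e : A ≃ A') :
    Fin (size A) ≃ Fin (size A') :=
  (code.symm.trans e).trans code

theorem transport_trans {A A' A'' : Type} [FinCoded A] [FinCoded A'] [FinCoded A'']
    (e : A ≃ A') (e' : A' ≃ A'') :
    transport (e.trans e') = (transport e).trans (transport e') := by
  ext x; simp [transport]

theorem transport_refl {A : Type} [FinCoded A] :
    transport (Equiv.refl A) = Equiv.refl _ := by
  ext x; simp [transport]

/-- The disjoint union of two bijections between initial segments. -/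
def finSumCongr {a a' b b' : ℕ} (e : Fin a ≃ Fin a') (f : Fin b ≃ Fin b') :
    Fin (a + b) ≃ Fin (a' + b') :=
  (finSumFinEquiv.symm.trans (Equiv.sumCongr e f)).trans finSumFinEquiv

theorem finSumCongr_castAdd {a a' b b' : ℕ} (e : Fin a ≃ Fin a') (f : Fin b ≃ Fin b')
    (i : Fin a) : finSumCongr e f (Fin.castAdd b i) = Fin.castAdd b' (e i) := by
  simp [finSumCongr]

theorem finSumCongr_natAdd {a a' b b' : ℕ} (e : Fin a ≃ Fin a') (f : Fin b ≃ Fin b')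
    (i : Fin b) : finSumCongr e f (Fin.natAdd a i) = Fin.natAdd a' (f i) := by
  simp [finSumCongr]

theorem code_inl {A B : Type} [FinCoded A] [FinCoded B] (a : A) :
    code (Sum.inl a : A ⊕ B) = Fin.castAdd (size B) (code a) := rfl

theorem code_inr {A B : Type} [FinCoded A] [FinCoded B] (b : B) :
    code (Sum.inr b : A ⊕ B) = Fin.natAdd (size A) (code b) := rfl

theorem transport_eq {A A' : Type} [FinCoded A] [FinCoded A'] {e : A ≃ A'}
    {g : Fin (size A) ≃ Fin (size A')} (h : ∀ a, code (e a) = g (code a)) : transport e = g := by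
  apply Equiv.ext
  intro x
  obtain ⟨a, rfl⟩ := code.surjective x
  simpa [transport] using h a

theorem transport_sumCongr {A A' B B' : Type} [FinCoded A] [FinCoded A'] [FinCoded B]
    [FinCoded B'] (e : A ≃ A') (f : B ≃ B') :
    transport (Equiv.sumCongr e f) = finSumCongr (transport e) (transport f) := by
  refine transport_eq ?_
  rintro (a | b)
  · rw [code_inl]
    refine Eq.trans ?_ (finSumCongr_castAdd _ _ _).symm
    simp [transport, code_inl]
  · rw [code_inr]
    refine Eq.trans ?_ (finSumCongr_natAdd _ _ _).symm
    simp [transport, code_inr]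

theorem transport_sumAssoc {A B C : Type} [FinCoded A] [FinCoded B] [FinCoded C] :
    transport (Equiv.sumAssoc A B C) = finCongr (Nat.add_assoc _ _ _) := by
  refine transport_eq ?_
  rintro ((a | b) | c)
  · rfl
  · rfl
  · exact Fin.ext (Nat.add_assoc _ _ _).symm

theorem transport_sumEmpty {A : Type} [FinCoded A] :
    transport (Equiv.sumEmpty A (Fin 0)) = Equiv.refl _ := by
  refine transport_eq ?_
  rintro (a | a)
  · rfl
  · exact a.elim0

theorem transport_finSumFinEquiv {m n : ℕ} :
    transport (finSumFinEquiv : Fin m ⊕ Fin n ≃ Fin (m + n)) = Equiv.refl _ := by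
  refine transport_eq ?_
  rintro (a | a) <;> rfl

theorem transport_sumComm {A B : Type} [FinCoded A] [FinCoded B] :
    transport (Equiv.sumComm A B) = finAddFlip := by
  refine transport_eq ?_
  rintro (a | a)
  · exact (finAddFlip_apply_castAdd _ _).symm
  · exact (finAddFlip_apply_natAdd _ _).symm

end FinCoded

open FinCoded

/-! ### Renaming of entries and exits. -/

namespace SymmModule

variable {K : Type u} [Field K] (P : SymmModule.{u, v} K)

/-- Renumbering of the entries and of the exits. -/
def finMap {k k' l l' : ℕ} (e : Fin k ≃ Fin k') (f : Fin l ≃ Fin l') (p : P.carrier k l) :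
    P.carrier k' l' :=
  P.cast (Fin.equiv_iff_eq.1 ⟨e⟩) (Fin.equiv_iff_eq.1 ⟨f⟩)
    (P.ract (e.trans (finCongr (Fin.equiv_iff_eq.1 ⟨e⟩).symm)).symm
      (P.lact (f.trans (finCongr (Fin.equiv_iff_eq.1 ⟨f⟩).symm)) p))

/-- Entries are pushed forward along `e`, so the right action enters through the inverse; this makes
`finMap` covariant in both arguments. -/
theorem finMap_perm {k l : ℕ} (e : Equiv.Perm (Fin k)) (f : Equiv.Perm (Fin l))
    (p : P.carrier k l) : P.finMap e f p = P.ract e⁻¹ (P.lact f p) := rfl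

theorem finMap_refl {k l : ℕ} (p : P.carrier k l) :
    P.finMap (Equiv.refl _) (Equiv.refl _) p = p := by
  rw [finMap_perm]
  exact (P.one_ract _).trans (P.one_lact _)

theorem finMap_finMap {k k' k'' l l' l'' : ℕ} (e : Fin k ≃ Fin k') (f : Fin l ≃ Fin l')
    (e' : Fin k' ≃ Fin k'') (f' : Fin l' ≃ Fin l'') (p : P.carrier k l) :
    P.finMap e' f' (P.finMap e f p) = P.finMap (e.trans e') (f.trans f') p := by
  obtain rfl := Fin.equiv_iff_eq.1 ⟨e⟩
  obtain rfl := Fin.equiv_iff_eq.1 ⟨e'⟩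
  obtain rfl := Fin.equiv_iff_eq.1 ⟨f⟩
  obtain rfl := Fin.equiv_iff_eq.1 ⟨f'⟩
  simp only [finMap_perm]
  rw [P.lact_ract, ← P.mul_ract, ← P.mul_lact]
  rfl

theorem cast_eq_finMap {k k' l l' : ℕ} (hk : k = k') (hl : l = l') (p : P.carrier k l) :
    P.cast hk hl p = P.finMap (finCongr hk) (finCongr hl) p := by
  subst hk hl
  exact (P.finMap_refl p).symm

theorem lact_eq_finMap {k l : ℕ} (σ : Equiv.Perm (Fin l)) (p : P.carrier k l) :
    P.lact σ p = P.finMap (Equiv.refl _) σ p := (P.one_ract _).symm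

theorem ract_eq_finMap {k l : ℕ} (τ : Equiv.Perm (Fin k)) (p : P.carrier k l) :
    P.ract τ p = P.finMap τ.symm (Equiv.refl _) p := by
  rw [finMap_perm]
  exact congrArg (P.ract τ) (P.one_lact p).symm

/-- The elements of `P` with entries numbered by `A` and exits numbered by `B`. -/
def Lab (A B : Type) [FinCoded A] [FinCoded B] : Type v := P.carrier (size A) (size B)

/-- Renaming of the entries and of the exits. -/
def relabel {A A' B B' : Type} [FinCoded A] [FinCoded A'] [FinCoded B] [FinCoded B']
    (e : A ≃ A') (f : B ≃ B') (p : P.Lab A B) : P.Lab A' B' :=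
  P.finMap (transport e) (transport f) p

variable {A A' A'' B B' B'' : Type} [FinCoded A] [FinCoded A'] [FinCoded A''] [FinCoded B]
  [FinCoded B'] [FinCoded B'']

theorem relabel_relabel (e : A ≃ A') (f : B ≃ B') (e' : A' ≃ A'') (f' : B' ≃ B'')
    (p : P.Lab A B) :
    P.relabel e' f' (P.relabel e f p) = P.relabel (e.trans e') (f.trans f') p := by
  simp only [relabel, transport_trans]
  exact P.finMap_finMap _ _ _ _ _

theorem relabel_refl (p : P.Lab A B) : P.relabel (Equiv.refl A) (Equiv.refl B) p = p := by
  simp only [relabel, transport_refl]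
  exact P.finMap_refl _

theorem relabel_eq_iff (e : A ≃ A') (f : B ≃ B') (p : P.Lab A B) (q : P.Lab A' B') :
    P.relabel e f p = q ↔ p = P.relabel e.symm f.symm q := by
  constructor
  · rintro rfl
    rw [relabel_relabel, Equiv.self_trans_symm, Equiv.self_trans_symm, relabel_refl]
  · rintro rfl
    rw [relabel_relabel, Equiv.symm_trans_self, Equiv.symm_trans_self, relabel_refl]

end SymmModule

/-! ### Horizontal concatenation of labelled elements. -/

namespace TraP

variable {K : Type u} [Field K] (P : TraP.{u, v} K)

/-- The horizontal concatenation, for labelled entries and exits. -/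
def mul {A B A' B' : Type} [FinCoded A] [FinCoded B] [FinCoded A'] [FinCoded B']
    (p : P.Lab A B) (q : P.Lab A' B') : P.Lab (A ⊕ A') (B ⊕ B') :=
  P.hmul (k := size A) (l := size B) (k' := size A') (l' := size B') p q

/-- A bijection between initial segments forces equal sizes; after substitution this is the axiom
`hmul_act`. -/
theorem hmul_finMap {k l k' l' k₁ l₁ k₁' l₁' : ℕ} (e : Fin k ≃ Fin k₁) (f : Fin l ≃ Fin l₁)
    (e' : Fin k' ≃ Fin k₁') (f' : Fin l' ≃ Fin l₁') (p : P.carrier k l) (q : P.carrier k' l') :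
    P.hmul (P.finMap e f p) (P.finMap e' f' q) =
      P.finMap (finSumCongr e e') (finSumCongr f f') (P.hmul p q) := by
  obtain rfl := Fin.equiv_iff_eq.1 ⟨e⟩
  obtain rfl := Fin.equiv_iff_eq.1 ⟨e'⟩
  obtain rfl := Fin.equiv_iff_eq.1 ⟨f⟩
  obtain rfl := Fin.equiv_iff_eq.1 ⟨f'⟩
  simp only [SymmModule.finMap_perm, P.hmul_act]
  rfl

variable {A A' A'' A₁ A₁' B B' B'' B₁ B₁' C C' D : Type} [FinCoded A] [FinCoded A']
  [FinCoded A''] [FinCoded A₁] [FinCoded A₁'] [FinCoded B] [FinCoded B'] [FinCoded B'']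
  [FinCoded B₁] [FinCoded B₁'] [FinCoded C] [FinCoded C'] [FinCoded D]

theorem mul_relabel (e : A ≃ A₁) (f : B ≃ B₁) (e' : A' ≃ A₁') (f' : B' ≃ B₁') (p : P.Lab A B)
    (q : P.Lab A' B') :
    P.mul (P.relabel e f p) (P.relabel e' f' q) =
      P.relabel (Equiv.sumCongr e e') (Equiv.sumCongr f f') (P.mul p q) := by
  simp only [mul, SymmModule.relabel, transport_sumCongr]
  exact P.hmul_finMap _ _ _ _ _ _

theorem mul_relabel_left (e : A ≃ A₁) (f : B ≃ B₁) (p : P.Lab A B) (q : P.Lab A' B') :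
    P.mul (P.relabel e f p) q =
      P.relabel (Equiv.sumCongr e (Equiv.refl _)) (Equiv.sumCongr f (Equiv.refl _))
        (P.mul p q) := by
  rw [← mul_relabel, P.relabel_refl]

theorem mul_relabel_right (e : A' ≃ A₁') (f : B' ≃ B₁') (p : P.Lab A B) (q : P.Lab A' B') :
    P.mul p (P.relabel e f q) =
      P.relabel (Equiv.sumCongr (Equiv.refl _) e) (Equiv.sumCongr (Equiv.refl _) f)
        (P.mul p q) := by
  rw [← mul_relabel, P.relabel_refl]

theorem mul_assoc (p : P.Lab A B) (q : P.Lab A' B') (r : P.Lab A'' B'') :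
    P.mul p (P.mul q r) =
      P.relabel (Equiv.sumAssoc _ _ _) (Equiv.sumAssoc _ _ _) (P.mul (P.mul p q) r) := by
  simp only [SymmModule.relabel, transport_sumAssoc]
  exact (P.hmul_assoc _ _ _).symm.trans (P.cast_eq_finMap _ _ _)

/-- The axiom has a block permutation on each side; moving the right action across turns it into a
renaming that swaps the summands of entries and exits. -/
theorem mul_comm (p : P.Lab A B) (q : P.Lab A' B') :
    P.mul q p = P.relabel (Equiv.sumComm _ _) (Equiv.sumComm _ _) (P.mul p q) := by
  have h := P.hmul_comm (k := size A) (l := size B) (k' := size A') (l' := size B') p q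
  rw [P.cast_eq_finMap, P.lact_eq_finMap, P.ract_eq_finMap, P.finMap_finMap] at h
  have h' := congrArg (P.finMap (finAddFlip (m := size A) (n := size A'))
    (finCongr (Nat.add_comm (size B) (size B')))) h
  rw [P.finMap_finMap, P.finMap_finMap] at h'
  simp only [SymmModule.relabel, transport_sumComm]
  refine Eq.trans ?_ (h'.symm.trans ?_)
  · refine (P.finMap_refl _).symm.trans ?_
    congr 1
    · apply Equiv.ext
      intro x
      obtain ⟨y, rfl⟩ : ∃ y, y = (blockSwap (size A) (size A')).symm
        (finCongr (Nat.add_comm _ _) x) := ⟨_, rfl⟩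
      simp [blockSwap]
  · congr 1

theorem mul_unit₀ (p : P.Lab A B) :
    P.mul (B' := Fin 0) (A' := Fin 0) p P.unit₀ =
      P.relabel (Equiv.sumEmpty _ _).symm (Equiv.sumEmpty _ _).symm p := by
  rw [eq_comm, P.relabel_eq_iff]
  simp only [SymmModule.relabel, Equiv.symm_symm, transport_sumEmpty]
  exact ((P.finMap_refl _).trans (P.hmul_unit₀ _)).symm

/-! ### The trace of a single pair. -/

/-- The trace of the last entry and the last exit. -/
def trOne (p : P.Lab (A ⊕ Fin 1) (B ⊕ Fin 1)) : P.Lab A B :=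
  P.tr (Fin.last (size A)) (Fin.last (size B)) p

theorem deleteLetter_finSumCongr {n : ℕ} (e : Equiv.Perm (Fin n)) :
    deleteLetter (finSumCongr e (Equiv.refl (Fin 1))) (Fin.last n) = e := by
  apply Equiv.ext
  intro x
  apply Fin.succAbove_right_injective (p := Fin.last n)
  have h : (finSumCongr e (Equiv.refl (Fin 1))).symm (Fin.last n) = Fin.last n :=
    (Equiv.symm_apply_eq _).2 (finSumCongr_natAdd e (Equiv.refl (Fin 1)) 0).symm
  rw [succAbove_deleteLetter, h, Fin.succAbove_last]
  exact finSumCongr_castAdd e (Equiv.refl (Fin 1)) x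

theorem tr_last_finMap {k k' l l' : ℕ} (e : Fin k ≃ Fin k') (f : Fin l ≃ Fin l')
    (p : P.carrier (k + 1) (l + 1)) :
    P.tr (Fin.last k') (Fin.last l')
      (P.finMap (finSumCongr e (Equiv.refl _)) (finSumCongr f (Equiv.refl _)) p) =
    P.finMap e f (P.tr (Fin.last k) (Fin.last l) p) := by
  obtain rfl := Fin.equiv_iff_eq.1 ⟨e⟩
  obtain rfl := Fin.equiv_iff_eq.1 ⟨f⟩
  have h {n : ℕ} (e : Equiv.Perm (Fin n)) :
      (finSumCongr e (Equiv.refl (Fin 1)))⁻¹ (Fin.last n) = Fin.last n :=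
    (Equiv.symm_apply_eq _).2 (finSumCongr_natAdd e (Equiv.refl (Fin 1)) 0).symm
  simp only [SymmModule.finMap_perm]
  refine (P.tr_act _ _ _ _ _).trans ?_
  rw [h, h, deleteLetter_finSumCongr]
  congr 2
  exact deleteLetter_finSumCongr e.symm

/-- If nothing is left of the permutations once the traced letters are deleted, the renaming only
changes which pair is traced. -/
theorem tr_finMap {k l : ℕ} (e : Equiv.Perm (Fin (k + 1))) (f : Equiv.Perm (Fin (l + 1)))
    (i : Fin (k + 1)) (j : Fin (l + 1)) (he : deleteLetter e⁻¹ (e⁻¹ i) = 1)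
    (hf : deleteLetter f j = 1) (p : P.carrier (k + 1) (l + 1)) :
    P.tr i j (P.finMap e f p) = P.tr (e⁻¹ i) (f⁻¹ j) p := by
  rw [SymmModule.finMap_perm, P.tr_act, he, hf]
  exact (P.one_ract _).trans (P.one_lact _)

theorem deleteLetter_swap_last (n : ℕ) :
    deleteLetter (Equiv.swap (Fin.last n).castSucc (Fin.last (n + 1))) (Fin.last (n + 1)) = 1 := by
  apply Equiv.ext
  intro x
  apply Fin.succAbove_right_injective (p := Fin.last (n + 1))
  rw [succAbove_deleteLetter]
  simp only [Equiv.symm_swap, Equiv.swap_apply_right]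
  induction x using Fin.lastCases with
  | last => simp
  | cast i =>
    simp only [Equiv.Perm.coe_one, id_eq, Fin.succAbove_last]
    rw [Fin.succAbove_of_castSucc_lt]
    · apply Equiv.swap_apply_of_ne_of_ne <;> simp [Fin.ext_iff] <;> omega
    · simp [Fin.lt_def]

theorem deleteLetter_swap_castSucc_last (n : ℕ) :
    deleteLetter (Equiv.swap (Fin.last n).castSucc (Fin.last (n + 1))) (Fin.last n).castSucc =
      1 := by
  apply Equiv.ext
  intro x
  apply Fin.succAbove_right_injective (p := (Fin.last n).castSucc)
  rw [succAbove_deleteLetter]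
  simp only [Equiv.symm_swap, Equiv.swap_apply_left]
  induction x using Fin.lastCases with
  | last => simp
  | cast i =>
    simp only [Equiv.Perm.coe_one, id_eq, Fin.succAbove_last]
    rw [Fin.succAbove_of_castSucc_lt]
    · apply Equiv.swap_apply_of_ne_of_ne <;> simp [Fin.ext_iff] <;> omega
    · simp [Fin.lt_def]

theorem deleteLetter_one {n : ℕ} (a : Fin (n + 1)) : deleteLetter 1 a = 1 := by
  apply Equiv.ext
  intro x
  apply Fin.succAbove_right_injective (p := a)
  rw [succAbove_deleteLetter]
  rfl

/-- The swap makes the inner trace act on the penultimate pair; `tr_tr` says that this, followed by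
the last pair, equals tracing the two pairs in the other order. -/
theorem tr_last_tr_last {k l : ℕ} (p : P.carrier (k + 2) (l + 2)) :
    P.tr (Fin.last k) (Fin.last l) (P.tr (Fin.last (k + 1)) (Fin.last (l + 1))
        (P.finMap (Equiv.swap (Fin.last k).castSucc (Fin.last (k + 1)))
          (Equiv.swap (Fin.last l).castSucc (Fin.last (l + 1))) p)) =
      P.tr (Fin.last k) (Fin.last l) (P.tr (Fin.last (k + 1)) (Fin.last (l + 1)) p) := by
  rw [P.tr_finMap, eq_comm, P.tr_tr]
  · simp
  · simpa using deleteLetter_swap_castSucc_last k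
  · exact deleteLetter_swap_last l

theorem cycleIcc_last (n : ℕ) : Fin.cycleIcc (Fin.last n) (Fin.last n) = 1 := by
  exact Fin.cycleIcc_eq

/-- The swap wires the last exit of `p` to the entry of `I`. For the last exit, the cycle in the
axiom runs over one element and disappears. -/
theorem tr_last_hmul_unit₁_exit {k l : ℕ} (p : P.carrier k (l + 1)) :
    P.tr (Fin.last k) (Fin.last (l + 1))
      (P.finMap (Equiv.refl _) (Equiv.swap (Fin.last l).castSucc (Fin.last (l + 1)))
        (P.hmul p P.unit₁)) = p := by
  refine (P.tr_finMap (k := k) (l := l + 1) 1 (Equiv.swap (Fin.last l).castSucc (Fin.last (l + 1)))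
    (Fin.last k) (Fin.last (l + 1)) (deleteLetter_one _) (deleteLetter_swap_last l)
    (P.hmul p P.unit₁)).trans ?_
  refine Eq.trans ?_ ((P.tr_hmul_unit₁_exit (Fin.last l) p).trans ?_)
  · rw [Equiv.swap_inv, Equiv.swap_apply_right]
    rfl
  · rw [cycleIcc_last, inv_one, P.one_lact]

theorem tr_last_hmul_unit₁_entry {k l : ℕ} (p : P.carrier (k + 1) l) :
    P.tr (Fin.last (k + 1)) (Fin.last l)
      (P.finMap (Equiv.swap (Fin.last k).castSucc (Fin.last (k + 1))) (Equiv.refl _)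
        (P.hmul p P.unit₁)) = p := by
  refine (P.tr_finMap (k := k + 1) (l := l) (Equiv.swap (Fin.last k).castSucc (Fin.last (k + 1))) 1
    (Fin.last (k + 1)) (Fin.last l) ?_ (deleteLetter_one _) (P.hmul p P.unit₁)).trans ?_
  · simpa using deleteLetter_swap_castSucc_last k
  refine Eq.trans ?_ ((P.tr_hmul_unit₁_entry (Fin.last k) p).trans ?_)
  · rw [Equiv.swap_inv, Equiv.swap_apply_right]
    rfl
  · rw [cycleIcc_last, P.one_ract]

/-- The last two summands, exchanged. -/
def sumSwap (A B C : Type) : (A ⊕ B) ⊕ C ≃ (A ⊕ C) ⊕ B :=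
  ((Equiv.sumAssoc A B C).trans (Equiv.sumCongr (Equiv.refl A) (Equiv.sumComm B C))).trans
    (Equiv.sumAssoc A C B).symm

theorem transport_sumSwap :
    transport (sumSwap A (Fin 1) (Fin 1)) =
      Equiv.swap (Fin.last (size A)).castSucc (Fin.last (size A + 1)) := by
  refine transport_eq ?_
  rintro ((a | a) | a)
  · refine (Equiv.swap_apply_of_ne_of_ne ?_ ?_).symm
    · exact Fin.ne_of_lt (code a).2
    · exact Fin.ne_of_lt ((code a).2.trans (Nat.lt_succ_self _))
  · obtain rfl : a = 0 := Subsingleton.elim _ _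
    exact (Equiv.swap_apply_left _ _).symm
  · obtain rfl : a = 0 := Subsingleton.elim _ _
    exact (Equiv.swap_apply_right _ _).symm

theorem trOne_relabel (e : A ≃ A') (f : B ≃ B') (p : P.Lab (A ⊕ Fin 1) (B ⊕ Fin 1)) :
    P.trOne (P.relabel (Equiv.sumCongr e (Equiv.refl _)) (Equiv.sumCongr f (Equiv.refl _)) p) =
      P.relabel e f (P.trOne p) := by
  simp only [SymmModule.relabel, transport_sumCongr, transport_refl]
  exact P.tr_last_finMap _ _ _

theorem trOne_trOne (p : P.Lab ((A ⊕ Fin 1) ⊕ Fin 1) ((B ⊕ Fin 1) ⊕ Fin 1)) :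
    P.trOne (P.trOne (P.relabel (sumSwap _ _ _) (sumSwap _ _ _) p)) = P.trOne (P.trOne p) := by
  simp only [SymmModule.relabel, transport_sumSwap]
  exact P.tr_last_tr_last _

theorem relabel_eq_of_transport {A A' B B' : Type} [FinCoded A] [FinCoded A'] [FinCoded B]
    [FinCoded B'] (hA : size A = size A') (hB : size B = size B') {e : A ≃ A'} {f : B ≃ B'}
    (he : transport e = finCongr hA) (hf : transport f = finCongr hB) (p : P.Lab A B) :
    P.relabel e f p = P.cast hA hB p := by
  simp only [SymmModule.relabel, he, hf]
  exact (P.cast_eq_finMap _ _ _).symm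

/-- Reassociating the sums does not change any number, so this is `tr_hmul_right` for the last pair.
-/
theorem mul_trOne (p : P.Lab A B) (q : P.Lab (A' ⊕ Fin 1) (B' ⊕ Fin 1)) :
    P.mul p (P.trOne q) =
      P.trOne (P.relabel (Equiv.sumAssoc _ _ _).symm (Equiv.sumAssoc _ _ _).symm
        (P.mul p q)) := by
  refine (P.tr_hmul_right _ _ _ _).symm.trans ?_
  have h := P.relabel_eq_of_transport (A := (A ⊕ A') ⊕ Fin 1) (B := (B ⊕ B') ⊕ Fin 1)
    (Nat.add_assoc _ _ _) (Nat.add_assoc _ _ _) transport_sumAssoc transport_sumAssoc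
    (P.hmul (k := size A) (l := size B) (k' := size A' + 1) (l' := size B' + 1) p q)
  exact congrArg (P.trOne (A := A ⊕ A') (B := B ⊕ B')) ((P.relabel_eq_iff _ _ _ _).1 h)

theorem trOne_mul_unit₁_exit (p : P.Lab A (B ⊕ Fin 1)) :
    P.trOne (P.relabel (Equiv.refl _) (sumSwap _ _ _)
      (P.mul (A' := Fin 1) (B' := Fin 1) p P.unit₁)) = p := by
  simp only [SymmModule.relabel, transport_sumSwap, transport_refl]
  exact P.tr_last_hmul_unit₁_exit _

theorem trOne_mul_unit₁_entry (p : P.Lab (A ⊕ Fin 1) B) :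
    P.trOne (P.relabel (sumSwap _ _ _) (Equiv.refl _)
      (P.mul (A' := Fin 1) (B' := Fin 1) p P.unit₁)) = p := by
  simp only [SymmModule.relabel, transport_sumSwap, transport_refl]
  exact P.tr_last_hmul_unit₁_entry _

/-! ### The iterated trace and its invariance under permutations. -/

theorem sumFin_equiv_ext {A X : Type} {m n : ℕ} {e f : A ⊕ Fin (m + n) ≃ X}
    (hA : ∀ a, e (Sum.inl a) = f (Sum.inl a))
    (hm : ∀ i, e (Sum.inr (Fin.castAdd n i)) = f (Sum.inr (Fin.castAdd n i)))
    (hn : ∀ i, e (Sum.inr (Fin.natAdd m i)) = f (Sum.inr (Fin.natAdd m i))) : e = f := by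
  apply Equiv.ext
  rintro (a | i)
  · exact hA a
  · exact Fin.addCases hm hn i

/-- Splits off the last element. -/
def splitLast (A : Type) (n : ℕ) : A ⊕ Fin (n + 1) ≃ (A ⊕ Fin n) ⊕ Fin 1 :=
  (Equiv.sumCongr (Equiv.refl A) finSumFinEquiv.symm).trans (Equiv.sumAssoc A (Fin n) (Fin 1)).symm

/-- The iterated trace of the last `n` entries and exits. -/
def trFin : ∀ n : ℕ, P.Lab (A ⊕ Fin n) (B ⊕ Fin n) → P.Lab A B
  | 0, p => P.relabel (Equiv.sumEmpty A (Fin 0)) (Equiv.sumEmpty B (Fin 0)) p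
  | n + 1, p => trFin n (P.trOne (P.relabel (splitLast A n) (splitLast B n) p))

theorem splitLast_inl {A : Type} {n : ℕ} (a : A) :
    splitLast A n (Sum.inl a) = Sum.inl (Sum.inl a) := rfl

theorem splitLast_castSucc {A : Type} {n : ℕ} (i : Fin n) :
    splitLast A n (Sum.inr i.castSucc) = Sum.inl (Sum.inr i) := by
  change (Equiv.sumAssoc A (Fin n) (Fin 1)).symm
    (Sum.inr (finSumFinEquiv.symm (Fin.castAdd 1 i))) = _
  rw [finSumFinEquiv_symm_apply_castAdd]
  rfl

theorem splitLast_last {A : Type} {n : ℕ} :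
    splitLast A n (Sum.inr (Fin.last n)) = Sum.inr 0 := by
  change (Equiv.sumAssoc A (Fin n) (Fin 1)).symm
    (Sum.inr (finSumFinEquiv.symm (Fin.natAdd n 0))) = _
  rw [finSumFinEquiv_symm_apply_natAdd]
  rfl

theorem trFin_relabel (e : A ≃ A') (f : B ≃ B') {n : ℕ} (p : P.Lab (A ⊕ Fin n) (B ⊕ Fin n)) :
    P.trFin n (P.relabel (Equiv.sumCongr e (Equiv.refl _)) (Equiv.sumCongr f (Equiv.refl _)) p) =
      P.relabel e f (P.trFin n p) := by
  induction n with
  | zero =>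
    simp only [trFin, P.relabel_relabel]
    congr 1 <;> ext (x | x) <;> first | rfl | exact x.elim0
  | succ n ih =>
    simp only [trFin, P.relabel_relabel]
    rw [← ih, ← trOne_relabel, P.relabel_relabel]
    congr 3 <;> ext (x | x) <;> simp [splitLast] <;> cases finSumFinEquiv.symm x <;> rfl

theorem trFin_succ_finSumCongr {n : ℕ} (α : Equiv.Perm (Fin n))
    (h : ∀ p : P.Lab (A ⊕ Fin n) (B ⊕ Fin n),
      P.trFin n (P.relabel (Equiv.sumCongr (Equiv.refl _) α) (Equiv.sumCongr (Equiv.refl _) α) p) =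
        P.trFin n p) (p : P.Lab (A ⊕ Fin (n + 1)) (B ⊕ Fin (n + 1))) :
    P.trFin (n + 1) (P.relabel (Equiv.sumCongr (Equiv.refl _) (finSumCongr α (Equiv.refl (Fin 1))))
      (Equiv.sumCongr (Equiv.refl _) (finSumCongr α (Equiv.refl (Fin 1)))) p) =
        P.trFin (n + 1) p := by
  simp only [trFin]
  rw [← h (P.trOne (P.relabel (splitLast A n) (splitLast B n) p)), ← trOne_relabel,
    P.relabel_relabel, P.relabel_relabel]
  congr 3 <;> ext (x | x) <;> simp [splitLast, finSumCongr] <;>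
    cases finSumFinEquiv.symm x <;> rfl

theorem finSumCongr_swap {n : ℕ} (i j : Fin n) :
    finSumCongr (Equiv.swap i j) (Equiv.refl (Fin 1)) = Equiv.swap i.castSucc j.castSucc := by
  apply Equiv.ext
  intro x
  induction x using Fin.lastCases with
  | last =>
    rw [Equiv.swap_apply_of_ne_of_ne (Fin.castSucc_lt_last _).ne' (Fin.castSucc_lt_last _).ne']
    exact finSumCongr_natAdd (Equiv.swap i j) (Equiv.refl (Fin 1)) 0
  | cast x =>
    refine (finSumCongr_castAdd (Equiv.swap i j) (Equiv.refl (Fin 1)) x).trans ?_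
    exact (Fin.castSucc_injective n).map_swap _ _ _

theorem trFin_swap_last {n : ℕ} (p : P.Lab (A ⊕ Fin (n + 2)) (B ⊕ Fin (n + 2))) :
    P.trFin (n + 2) (P.relabel
      (Equiv.sumCongr (Equiv.refl _) (Equiv.swap (Fin.last n).castSucc (Fin.last (n + 1))))
      (Equiv.sumCongr (Equiv.refl _) (Equiv.swap (Fin.last n).castSucc (Fin.last (n + 1)))) p) =
        P.trFin (n + 2) p := by
  simp only [trFin, ← trOne_relabel, P.relabel_relabel]
  -- The swap inserted by commuting the two outermost traces cancels the transposition; `h` is this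
  -- cancellation on labels.
  rw [← trOne_trOne, P.relabel_relabel]
  have h (A : Type) : ((((Equiv.refl A).sumCongr
      (Equiv.swap (Fin.last n).castSucc (Fin.last (n + 1)))).trans (splitLast A (n + 1))).trans
      ((splitLast A n).sumCongr (Equiv.refl (Fin 1)))).trans
        (sumSwap (A ⊕ Fin n) (Fin 1) (Fin 1)) =
      (splitLast A (n + 1)).trans ((splitLast A n).sumCongr (Equiv.refl (Fin 1))) := by
    apply Equiv.ext
    rintro (a | i)
    · rfl
    · simp only [Equiv.trans_apply, Equiv.sumCongr_apply, Sum.map_inr]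
      induction i using Fin.lastCases with
      | last =>
        rw [Equiv.swap_apply_right, splitLast_castSucc, splitLast_last, Sum.map_inl, splitLast_last]
        rfl
      | cast i =>
        induction i using Fin.lastCases with
        | last =>
          rw [Equiv.swap_apply_left, splitLast_castSucc, splitLast_last, Sum.map_inl,
            splitLast_last]
          rfl
        | cast i =>
          rw [Equiv.swap_apply_of_ne_of_ne, splitLast_castSucc, Sum.map_inl, splitLast_castSucc]
          · rfl
          · exact fun h => (Fin.castSucc_lt_last i).ne (Fin.castSucc_injective _ h)
          · exact (Fin.castSucc_lt_last _).ne
  rw [h, h]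

/-- Adjacent transpositions generate the symmetric group. The last one is handled by commuting two
traces; the others fix the last index and come from the induction hypothesis. -/
theorem trFin_perm {n : ℕ} (α : Equiv.Perm (Fin n)) (p : P.Lab (A ⊕ Fin n) (B ⊕ Fin n)) :
    P.trFin n (P.relabel (Equiv.sumCongr (Equiv.refl _) α) (Equiv.sumCongr (Equiv.refl _) α) p) =
      P.trFin n p := by
  have h1 {n : ℕ} (p : P.Lab (A ⊕ Fin n) (B ⊕ Fin n)) :
      P.relabel (Equiv.sumCongr (Equiv.refl _) 1) (Equiv.sumCongr (Equiv.refl _) 1) p = p := by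
    refine Eq.trans ?_ (P.relabel_refl p)
    congr 1 <;> ext (x | x) <;> rfl
  induction n with
  | zero =>
    obtain rfl : α = 1 := Subsingleton.elim _ _
    rw [h1]
  | succ n ih =>
    have hα : α ∈ Submonoid.closure
        (Set.range fun i : Fin n ↦ Equiv.swap i.castSucc i.succ) := by
      rw [Equiv.Perm.mclosure_swap_castSucc_succ]; trivial
    induction hα using Submonoid.closure_induction generalizing p with
    | mem x hx =>
      obtain ⟨i, rfl⟩ := hx
      cases n with
      | zero => exact i.elim0
      | succ n =>
        induction i using Fin.lastCases with
        | last => exact P.trFin_swap_last p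
        | cast i =>
          have := P.trFin_succ_finSumCongr (Equiv.swap i.castSucc i.succ) (ih _) p
          rwa [finSumCongr_swap] at this
    | one => rw [h1]
    | mul x y _ _ hx hy =>
      rw [← hy p]
      refine Eq.trans ?_ (hx _)
      rw [P.relabel_relabel]
      congr 2 <;> ext (x | x) <;> rfl

theorem mul_trFin {n : ℕ} (p : P.Lab A B) (q : P.Lab (A' ⊕ Fin n) (B' ⊕ Fin n)) :
    P.mul p (P.trFin n q) =
      P.trFin n (P.relabel (Equiv.sumAssoc _ _ _).symm (Equiv.sumAssoc _ _ _).symm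
        (P.mul p q)) := by
  induction n with
  | zero =>
    simp only [trFin, P.relabel_relabel, mul_relabel_right]
    congr 1 <;> ext (x | x | x) <;> first | rfl | exact x.elim0
  | succ n ih =>
    simp only [trFin, P.relabel_relabel, ih, mul_relabel_right, mul_trOne, ← trOne_relabel]
    congr 3 <;> ext (x | x | x) <;> simp [splitLast] <;> cases finSumFinEquiv.symm x <;> rfl

theorem trFin_add {m n : ℕ} (p : P.Lab (A ⊕ Fin (m + n)) (B ⊕ Fin (m + n))) :
    P.trFin (m + n) p = P.trFin m (P.trFin n (P.relabel
      ((Equiv.sumCongr (Equiv.refl _) finSumFinEquiv.symm).trans (Equiv.sumAssoc _ _ _).symm)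
      ((Equiv.sumCongr (Equiv.refl _) finSumFinEquiv.symm).trans (Equiv.sumAssoc _ _ _).symm)
        p)) := by
  induction n with
  | zero =>
    simp only [trFin, P.relabel_relabel]
    refine congrArg (P.trFin m) ((P.relabel_refl p).symm.trans ?_)
    have h (A : Type) : Equiv.refl (A ⊕ Fin (m + 0)) = (((Equiv.refl A).sumCongr
        finSumFinEquiv.symm).trans (Equiv.sumAssoc A (Fin m) (Fin 0)).symm).trans
        (Equiv.sumEmpty (A ⊕ Fin m) (Fin 0)) := by
      refine sumFin_equiv_ext (fun a => rfl) (fun i => ?_) (fun i => i.elim0)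
      simp only [Equiv.trans_apply, Equiv.sumCongr_apply, Sum.map_inr,
        finSumFinEquiv_symm_apply_castAdd]
      rfl
    exact congrArg₂ (fun e f => P.relabel e f p) (h A) (h B)
  | succ n ih =>
    simp only [trFin]
    refine (ih _).trans ?_
    rw [← trOne_relabel, P.relabel_relabel, P.relabel_relabel]
    have h (A : Type) : (splitLast A (m + n)).trans
        ((((Equiv.refl A).sumCongr finSumFinEquiv.symm).trans
          (Equiv.sumAssoc A (Fin m) (Fin n)).symm).sumCongr (Equiv.refl (Fin 1))) =
        (((Equiv.refl A).sumCongr finSumFinEquiv.symm).trans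
          (Equiv.sumAssoc A (Fin m) (Fin (n + 1))).symm).trans (splitLast (A ⊕ Fin m) n) := by
      refine sumFin_equiv_ext (m := m) (n := n + 1) (fun a => rfl) (fun i => ?_) (fun i => ?_)
      · refine (congrArg _ (splitLast_castSucc (Fin.castAdd n i))).trans ?_
        simp only [Equiv.trans_apply, Equiv.sumCongr_apply, Sum.map_inr,
          finSumFinEquiv_symm_apply_castAdd]
        refine Eq.trans ?_ (splitLast_inl (A := A ⊕ Fin m) _).symm
        simp only [Function.comp_apply, Equiv.trans_apply, Equiv.sumCongr_apply, Sum.map_inr,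
          finSumFinEquiv_symm_apply_castAdd]
        rfl
      · simp only [Equiv.trans_apply, Equiv.sumCongr_apply, Sum.map_inr,
          finSumFinEquiv_symm_apply_natAdd]
        induction i using Fin.lastCases with
        | last =>
          exact (congrArg _ splitLast_last).trans (splitLast_last (A := A ⊕ Fin m)).symm
        | cast i =>
          refine (congrArg _ (splitLast_castSucc (Fin.natAdd m i))).trans
            (Eq.trans ?_ (splitLast_castSucc (A := A ⊕ Fin m) i).symm)
          simp only [Equiv.trans_apply, Equiv.sumCongr_apply, Sum.map_inr, Sum.map_inl,
            finSumFinEquiv_symm_apply_natAdd]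
          rfl
    refine congrArg (fun x => P.trFin m (P.trFin n (P.trOne x))) ?_
    exact congrArg₂ (fun e f => P.relabel e f p) (h A) (h B)

/-! ### The trace over a numbered type. -/

/-- The trace over the entries and exits labelled by `C`. -/
def trace (C : Type) [FinCoded C] (p : P.Lab (A ⊕ C) (B ⊕ C)) : P.Lab A B :=
  P.trFin (size C) (P.relabel (Equiv.sumCongr (Equiv.refl _) code)
    (Equiv.sumCongr (Equiv.refl _) code) p)

theorem trace_relabel (e : A ≃ A') (f : B ≃ B') (p : P.Lab (A ⊕ C) (B ⊕ C)) :
    P.trace C (P.relabel (Equiv.sumCongr e (Equiv.refl _)) (Equiv.sumCongr f (Equiv.refl _)) p) =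
      P.relabel e f (P.trace C p) := by
  simp only [trace, ← trFin_relabel, P.relabel_relabel]
  congr 2 <;> ext (x | x) <;> rfl

theorem trace_slide (g : C ≃ C') (p : P.Lab (A ⊕ C) (B ⊕ C)) :
    P.trace C' (P.relabel (Equiv.sumCongr (Equiv.refl _) g) (Equiv.sumCongr (Equiv.refl _) g) p) =
      P.trace C p := by
  simp only [trace, P.relabel_relabel]
  have h {m n : ℕ} (g : Fin m ≃ Fin n) (p : P.Lab (A ⊕ Fin m) (B ⊕ Fin m)) :
      P.trFin n (P.relabel (Equiv.sumCongr (Equiv.refl _) g) (Equiv.sumCongr (Equiv.refl _) g) p) =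
        P.trFin m p := by
    obtain rfl := Fin.equiv_iff_eq.1 ⟨g⟩
    exact P.trFin_perm g p
  rw [← h (transport g), P.relabel_relabel]
  congr 2 <;> ext (x | x) <;> simp [transport]

theorem trace_sum (p : P.Lab (A ⊕ (C ⊕ D)) (B ⊕ (C ⊕ D))) :
    P.trace (C ⊕ D) p = P.trace C (P.trace D (P.relabel (Equiv.sumAssoc _ _ _).symm
      (Equiv.sumAssoc _ _ _).symm p)) := by
  simp only [trace, ← trFin_relabel, P.relabel_relabel]
  refine (P.trFin_add _).trans ?_
  rw [P.relabel_relabel]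
  refine congrArg (fun x => P.trFin _ (P.trFin _ x)) ?_
  congr 1 <;> ext (x | x | x) <;> simp [code_inl, code_inr]

theorem mul_trace (p : P.Lab A B) (q : P.Lab (A' ⊕ C) (B' ⊕ C)) :
    P.mul p (P.trace C q) =
      P.trace C (P.relabel (Equiv.sumAssoc _ _ _).symm (Equiv.sumAssoc _ _ _).symm
        (P.mul p q)) := by
  simp only [trace, mul_trFin, P.relabel_relabel, mul_relabel_right]
  congr 2 <;> ext (x | x | x) <;> rfl

/-- Commutativity of the product reduces this to `mul_trace`. -/
theorem trace_mul (p : P.Lab A B) (q : P.Lab (A' ⊕ C) (B' ⊕ C)) :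
    P.mul (P.trace C q) p =
      P.trace C (P.relabel (sumSwap _ _ _) (sumSwap _ _ _) (P.mul q p)) := by
  rw [P.mul_comm p, mul_trace, ← trace_relabel, P.mul_comm q, P.relabel_relabel, P.relabel_relabel]
  congr 2 <;> ext ((x | x) | x) <;> rfl

/-! ### Vertical composition: associativity, interchange, equivariance. -/

/-- The vertical concatenation, for labelled entries and exits. -/
def comp (q : P.Lab B D) (p : P.Lab A B) : P.Lab A D :=
  P.trace B (P.relabel (Equiv.refl _) (Equiv.sumComm _ _) (P.mul p q))

/-- Both sides are traces over a disjoint union, `C ⊕ D` or `D ⊕ C`, and traced labels may be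
renamed along `Equiv.sumComm`. -/
theorem trace_trace (p : P.Lab ((A ⊕ C) ⊕ D) ((B ⊕ C) ⊕ D)) :
    P.trace C (P.trace D p) =
      P.trace D (P.trace C (P.relabel (sumSwap _ _ _) (sumSwap _ _ _) p)) := by
  have h (C D : Type) [FinCoded C] [FinCoded D] (p : P.Lab ((A ⊕ C) ⊕ D) ((B ⊕ C) ⊕ D)) :
      P.trace C (P.trace D p) =
        P.trace (C ⊕ D) (P.relabel (Equiv.sumAssoc _ _ _) (Equiv.sumAssoc _ _ _) p) := by
    rw [trace_sum, P.relabel_relabel, Equiv.self_trans_symm, Equiv.self_trans_symm,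
      P.relabel_refl]
  rw [h, h, ← P.trace_slide (Equiv.sumComm C D), P.relabel_relabel, P.relabel_relabel]
  congr 2 <;> ext ((x | x) | x) <;> rfl

/-- Both sides are double traces, over `B` and `C`, of the product of `r`, `q` and `p`; only the
order of the traces differs. -/
theorem comp_assoc (p : P.Lab C D) (q : P.Lab B C) (r : P.Lab A B) :
    P.comp p (P.comp q r) = P.comp (P.comp p q) r := by
  simp only [comp, mul_trace, trace_mul, P.relabel_relabel, mul_relabel_left, mul_relabel_right,
    ← trace_relabel, mul_assoc]
  rw [trace_trace, P.relabel_relabel]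
  congr 3 <;> ext ((x | x) | x) <;> rfl

theorem mul_mul_mul_comm (p : P.Lab A B) (q : P.Lab A' B') (p' : P.Lab A₁ B₁)
    (q' : P.Lab A₁' B₁') :
    P.mul (P.mul p q) (P.mul p' q') =
      P.relabel (Equiv.sumSumSumComm _ _ _ _) (Equiv.sumSumSumComm _ _ _ _)
        (P.mul (P.mul p p') (P.mul q q')) := by
  rw [P.mul_assoc (P.mul p p'), P.mul_assoc (P.mul p q), eq_comm, P.relabel_relabel,
    (P.relabel_eq_iff _ _ _ _).1 (P.mul_assoc p p' q).symm,
    (P.relabel_eq_iff _ _ _ _).1 (P.mul_assoc p q p').symm, P.mul_comm p' q]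
  simp only [mul_relabel_left, mul_relabel_right, P.relabel_relabel]
  congr 1 <;> ext ((x | (x | x)) | x) <;> rfl

theorem mul_comp_mul (p : P.Lab B D) (p' : P.Lab B' C) (q : P.Lab A B) (q' : P.Lab A' B') :
    P.comp (P.mul p p') (P.mul q q') = P.mul (P.comp p q) (P.comp p' q') := by
  simp only [comp, mul_trace, trace_mul, P.relabel_relabel, mul_relabel_left, mul_relabel_right,
    ← trace_relabel, trace_sum]
  rw [mul_mul_mul_comm, P.relabel_relabel, trace_trace, P.relabel_relabel]
  congr 3 <;> ext ((x | x) | (x | x)) <;> rfl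

theorem relabel_comp (f : D ≃ C) (p : P.Lab B D) (q : P.Lab A B) :
    P.relabel (Equiv.refl _) f (P.comp p q) = P.comp (P.relabel (Equiv.refl _) f p) q := by
  simp only [comp, P.relabel_relabel, mul_relabel_right, ← trace_relabel]
  congr 2; ext (x | x) <;> rfl

theorem comp_relabel (e : A ≃ A') (p : P.Lab B D) (q : P.Lab A B) :
    P.relabel e (Equiv.refl _) (P.comp p q) = P.comp p (P.relabel e (Equiv.refl _) q) := by
  simp only [comp, P.relabel_relabel, mul_relabel_left, ← trace_relabel]
  congr 2; ext (x | x) <;> rfl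

theorem comp_relabel_relabel (e : B ≃ B') (f : D ≃ C) (d : A ≃ A') (p : P.Lab B D)
    (q : P.Lab A B) :
    P.comp (P.relabel e f p) (P.relabel d e q) = P.relabel d f (P.comp p q) := by
  simp only [comp, P.relabel_relabel, mul_relabel, ← trace_relabel]
  rw [← P.trace_slide e, P.relabel_relabel]
  congr 2 <;> ext (x | x) <;> rfl

theorem comp_slide (e : B ≃ B') (p : P.Lab B' D) (q : P.Lab A B) :
    P.comp (P.relabel e.symm (Equiv.refl _) p) q = P.comp p (P.relabel (Equiv.refl _) e q) := by
  have h := P.comp_relabel_relabel e (Equiv.refl _) (Equiv.refl _)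
    (P.relabel e.symm (Equiv.refl _) p) q
  rw [P.relabel_refl, P.relabel_relabel, Equiv.symm_trans_self, Equiv.refl_trans,
    P.relabel_refl] at h
  exact h.symm

/-! ### Units. -/

/-- `x` is a two-sided unit, in the strong form in which only a part of the exits (or of the
entries) is connected to it. -/
structure Yanks (C : Type) [FinCoded C] (x : P.Lab C C) : Prop where
  exit : ∀ {A B : Type} [FinCoded A] [FinCoded B] (p : P.Lab A (B ⊕ C)),
    P.trace C (P.relabel (Equiv.refl _) (sumSwap _ _ _) (P.mul p x)) = p
  entry : ∀ {A B : Type} [FinCoded A] [FinCoded B] (p : P.Lab (A ⊕ C) B),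
    P.trace C (P.relabel (sumSwap _ _ _) (Equiv.refl _) (P.mul p x)) = p

theorem trace_fin_zero (p : P.Lab (A ⊕ Fin 0) (B ⊕ Fin 0)) :
    P.trace (Fin 0) p = P.relabel (Equiv.sumEmpty _ _) (Equiv.sumEmpty _ _) p := by
  simp only [trace]
  refine (P.relabel_relabel _ _ _ _ _).trans ?_
  congr 1 <;> ext (x | x) <;> rfl

theorem trace_fin_one (p : P.Lab (A ⊕ Fin 1) (B ⊕ Fin 1)) :
    P.trace (Fin 1) p = P.trOne p := by
  refine (P.trOne_relabel _ _ _).symm.trans ?_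
  refine congrArg P.trOne (Eq.trans ?_ (P.relabel_refl p))
  rw [P.relabel_relabel]
  refine (P.relabel_relabel _ _ _ _ _).trans ?_
  have h (A : Type) : ((Equiv.sumCongr (Equiv.refl A) (code (A := Fin 1))).trans
      ((splitLast A 0).trans ((Equiv.sumEmpty A (Fin 0)).sumCongr (Equiv.refl (Fin 1))))) =
        Equiv.refl _ := by
    apply Equiv.ext
    rintro (a | i)
    · rfl
    · obtain rfl : i = Fin.last 0 := Subsingleton.elim _ _
      exact congrArg (Sum.map (Equiv.sumEmpty A (Fin 0)) (Equiv.refl (Fin 1)))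
        (splitLast_last (A := A) (n := 0))
  exact congrArg₂ (fun e f => P.relabel e f p) (h A) (h B)

theorem yanks_unit₀ : P.Yanks (Fin 0) P.unit₀ where
  exit p := by
    rw [trace_fin_zero, P.mul_unit₀, P.relabel_relabel, P.relabel_relabel]
    refine Eq.trans ?_ (P.relabel_refl p)
    congr 1
    ext (x | x)
    · rfl
    · exact x.elim0
  entry p := by
    rw [trace_fin_zero, P.mul_unit₀, P.relabel_relabel, P.relabel_relabel]
    refine Eq.trans ?_ (P.relabel_refl p)
    congr 1
    ext (x | x)
    · rfl
    · exact x.elim0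

theorem yanks_unit₁ : P.Yanks (Fin 1) P.unit₁ where
  exit p := by rw [trace_fin_one, trOne_mul_unit₁_exit]
  entry p := by rw [trace_fin_one, trOne_mul_unit₁_entry]

namespace Yanks

variable {P}

/-- The strong form of `Yanks` is needed here: `y` absorbs the labels `D` of `p * x` while the other
labels stay free, and then `x` absorbs `C`. -/
theorem mul {x : P.Lab C C} {y : P.Lab D D} (hx : P.Yanks C x) (hy : P.Yanks D y) :
    P.Yanks (C ⊕ D) (P.mul x y) where
  exit {A B} _ _ p := by
    -- `φ` brings the exits `D` of `p * x` to the end, for `y`; `ψ` brings the exits `C` of `p` to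
    -- the end, for `x`. `χ` exchanges the exits of `x` with the exits `C` of `p` and puts the
    -- latter at the end, to be traced against the entries of `x`.
    let φ := ((Equiv.sumAssoc B C D).symm.sumCongr (Equiv.refl C)).trans (sumSwap (B ⊕ C) D C)
    let ψ := (Equiv.sumAssoc B C D).symm.trans (sumSwap B C D)
    let χ := (((sumSwap B C C).sumCongr (Equiv.refl D)).trans (sumSwap (B ⊕ C) C D)).trans
      ((Equiv.sumAssoc B C D).sumCongr (Equiv.refl C))
    have h1 := congrArg (P.relabel (Equiv.refl _) ψ.symm)
      (hx.exit (P.relabel (Equiv.refl _) ψ p))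
    have h2 := congrArg (fun z => P.trace C (P.relabel (Equiv.refl _) χ z))
      (hy.exit (P.relabel (Equiv.refl _) φ (P.mul p x)))
    simp only [← trace_relabel, mul_relabel_left, P.relabel_relabel, Equiv.self_trans_symm,
      Equiv.refl_trans, P.relabel_refl] at h1 h2
    refine Eq.trans ?_ (h2.trans (Eq.trans ?_ h1))
    · rw [mul_assoc, trace_sum, P.relabel_relabel, P.relabel_relabel]
      congr 3
      · ext ((x | x) | x) <;> rfl
      · ext ((((x | (x | x)) | x) | x)) <;> rfl
    · congr 2
      · ext (x | x) <;> rfl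
      · ext ((x | (x | x)) | x) <;> rfl
  entry {A B} _ _ p := by
    let φ := ((Equiv.sumAssoc A C D).symm.sumCongr (Equiv.refl C)).trans (sumSwap (A ⊕ C) D C)
    let ψ := (Equiv.sumAssoc A C D).symm.trans (sumSwap A C D)
    let χ := (((sumSwap A C C).sumCongr (Equiv.refl D)).trans (sumSwap (A ⊕ C) C D)).trans
      ((Equiv.sumAssoc A C D).sumCongr (Equiv.refl C))
    have h1 := congrArg (P.relabel ψ.symm (Equiv.refl _))
      (hx.entry (P.relabel ψ (Equiv.refl _) p))
    have h2 := congrArg (fun z => P.trace C (P.relabel χ (Equiv.refl _) z))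
      (hy.entry (P.relabel φ (Equiv.refl _) (P.mul p x)))
    simp only [← trace_relabel, mul_relabel_left, P.relabel_relabel, Equiv.self_trans_symm,
      Equiv.refl_trans, P.relabel_refl] at h1 h2
    refine Eq.trans ?_ (h2.trans (Eq.trans ?_ h1))
    · rw [mul_assoc, trace_sum, P.relabel_relabel, P.relabel_relabel]
      congr 3
      · ext ((((x | (x | x)) | x) | x)) <;> rfl
      · ext ((x | x) | x) <;> rfl
    · congr 2
      · ext ((x | (x | x)) | x) <;> rfl
      · ext (x | x) <;> rfl

theorem relabel {x : P.Lab C C} (hx : P.Yanks C x) (g : C ≃ C') :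
    P.Yanks C' (P.relabel g g x) where
  exit {A B} _ _ p := by
    have h := congrArg (P.relabel (Equiv.refl _) ((Equiv.refl B).sumCongr g))
      (hx.exit (P.relabel (Equiv.refl _) ((Equiv.refl B).sumCongr g.symm) p))
    rw [← P.trace_relabel, ← P.trace_slide g, P.relabel_relabel _ _ _ _ p] at h
    simp only [mul_relabel_left, P.relabel_relabel, mul_relabel_right] at h ⊢
    refine Eq.trans ?_ (h.trans (Eq.trans ?_ (P.relabel_refl p)))
    · congr 2
      · ext (x | x) <;> rfl
      · ext ((x | x) | x) <;> simp [sumSwap]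
    · congr 1; ext (x | x) <;> simp
  entry {A B} _ _ p := by
    have h := congrArg (P.relabel ((Equiv.refl A).sumCongr g) (Equiv.refl _))
      (hx.entry (P.relabel ((Equiv.refl A).sumCongr g.symm) (Equiv.refl _) p))
    rw [← P.trace_relabel, ← P.trace_slide g, P.relabel_relabel _ _ _ _ p] at h
    simp only [mul_relabel_left, P.relabel_relabel, mul_relabel_right] at h ⊢
    refine Eq.trans ?_ (h.trans (Eq.trans ?_ (P.relabel_refl p)))
    · congr 2
      · ext ((x | x) | x) <;> simp [sumSwap]
      · ext (x | x) <;> rfl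
    · congr 1; ext (x | x) <;> simp

theorem comp_unit {x : P.Lab C C} (hx : P.Yanks C x) (p : P.Lab C B) : P.comp p x = p := by
  -- With no free entries beside `C`, yanking wires `x` to all entries of `p`.
  have h := congrArg (P.relabel (Equiv.emptySum (Fin 0) C) (Equiv.refl B))
    (hx.entry (P.relabel (Equiv.emptySum (Fin 0) C).symm (Equiv.refl B) p))
  simp only [← trace_relabel, mul_relabel_left, P.relabel_relabel] at h
  refine Eq.trans ?_ (h.trans (Eq.trans ?_ (P.relabel_refl p)))
  · rw [comp, P.mul_comm p x, P.relabel_relabel]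
    congr 2 <;> ext (x | x) <;> rfl
  · congr 1

theorem unit_comp {x : P.Lab C C} (hx : P.Yanks C x) (p : P.Lab A C) : P.comp x p = p := by
  have h := congrArg (P.relabel (Equiv.refl A) (Equiv.emptySum (Fin 0) C))
    (hx.exit (P.relabel (Equiv.refl A) (Equiv.emptySum (Fin 0) C).symm p))
  simp only [← trace_relabel, mul_relabel_left, P.relabel_relabel] at h
  refine Eq.trans ?_ (h.trans (Eq.trans ?_ (P.relabel_refl p)))
  · rw [comp]
    congr 2 <;> ext (x | x) <;> rfl
  · congr 1

end Yanks

/-! ### Comparison with the original units and the original composition. -/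

theorem relabel_finSumFinEquiv {k k' l l' : ℕ}
    (p : P.Lab (Fin k ⊕ Fin k') (Fin l ⊕ Fin l')) :
    (P.relabel finSumFinEquiv finSumFinEquiv p : P.Lab (Fin (k + k')) (Fin (l + l'))) =
      (show P.carrier (k + k') (l + l') from p) := by
  simp only [SymmModule.relabel, transport_finSumFinEquiv]
  exact P.finMap_refl _

theorem yanks_hpow (n : ℕ) : P.Yanks (Fin n) (P.hpow P.unit₁ n) := by
  induction n with
  | zero => exact P.yanks_unit₀
  | succ n ih =>
    have h := (ih.mul P.yanks_unit₁).relabel finSumFinEquiv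
    rw [relabel_finSumFinEquiv] at h
    exact h

/-- Moves `j` to the last position, keeping the order of the other elements. -/
def moveLast {n : ℕ} (j : Fin (n + 1)) : Equiv.Perm (Fin (n + 1)) :=
  (finSuccEquiv' j).trans finSuccEquivLast.symm

theorem moveLast_self {n : ℕ} (j : Fin (n + 1)) : moveLast j j = Fin.last n := by
  simp [moveLast]

theorem moveLast_succAbove {n : ℕ} (j : Fin (n + 1)) (x : Fin n) :
    moveLast j (j.succAbove x) = x.castSucc := by
  simp [moveLast]

theorem moveLast_symm_last {n : ℕ} (j : Fin (n + 1)) : (moveLast j).symm (Fin.last n) = j := by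
  rw [Equiv.symm_apply_eq, moveLast_self]

theorem deleteLetter_moveLast {n : ℕ} (j : Fin (n + 1)) :
    deleteLetter (moveLast j) (Fin.last n) = 1 := by
  apply Equiv.ext
  intro x
  apply Fin.succAbove_right_injective (p := Fin.last n)
  rw [succAbove_deleteLetter, moveLast_symm_last, moveLast_succAbove, Fin.succAbove_last]
  rfl

/-- Moving exit `j` to the end keeps the others in order, so no permutation is left after the trace.
-/
theorem tr_last_eq {k l : ℕ} (j : Fin (l + 1)) (p : P.carrier (k + 1) (l + 1)) :
    P.tr (Fin.last k) j p =
      P.tr (Fin.last k) (Fin.last l) (P.finMap (Equiv.refl _) (moveLast j) p) := by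
  rw [show Equiv.refl (Fin (k + 1)) = 1 from rfl, P.tr_finMap 1 (moveLast j) (Fin.last k)
    (Fin.last l) (deleteLetter_one _) (deleteLetter_moveLast j)]
  exact congrArg (fun i => P.tr (Fin.last k) i p) (moveLast_symm_last j).symm

theorem transport_splitLast {n : ℕ} : transport (splitLast A n) = Equiv.refl _ := by
  refine transport_eq ?_
  rintro (a | i)
  · rfl
  · induction i using Fin.lastCases with
    | last => rw [splitLast_last]; rfl
    | cast i => rw [splitLast_castSucc]; rfl

theorem transport_move {l m : ℕ} :
    transport (((Equiv.sumComm (Fin (l + 1)) (Fin m)).trans (splitLast (Fin m) l)).trans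
      (Equiv.sumCongr (Equiv.sumComm _ _) (Equiv.refl _))) =
    (finCongr (Nat.add_right_comm l 1 m)).trans (moveLast ⟨l, by omega⟩) := by
  refine transport_eq ?_
  rintro (i | i)
  · induction i using Fin.lastCases with
    | last =>
      have h : ((Equiv.sumComm (Fin (l + 1)) (Fin m)).trans (splitLast (Fin m) l)).trans
          (Equiv.sumCongr (Equiv.sumComm _ _) (Equiv.refl (Fin 1))) (Sum.inl (Fin.last l)) =
          Sum.inr 0 :=
        congrArg (Sum.map (Sum.swap) id) (splitLast_last (A := Fin m) (n := l))
      rw [h]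
      exact (moveLast_self (⟨l, by omega⟩ : Fin (l + m + 1))).symm
    | cast i =>
      have h : ((Equiv.sumComm (Fin (l + 1)) (Fin m)).trans (splitLast (Fin m) l)).trans
          (Equiv.sumCongr (Equiv.sumComm _ _) (Equiv.refl (Fin 1))) (Sum.inl i.castSucc) =
          Sum.inl (Sum.inl i) :=
        congrArg (Sum.map (Sum.swap) id) (splitLast_castSucc (A := Fin m) (n := l) i)
      rw [h]
      refine (moveLast_succAbove (⟨l, by omega⟩ : Fin (l + m + 1)) (Fin.castAdd m i)).symm.trans ?_
      refine congrArg (moveLast _) (Fin.ext ?_)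
      rw [Fin.succAbove_of_castSucc_lt _ _ (Fin.lt_def.2 (by simp))]
      rfl
  · refine (moveLast_succAbove (⟨l, by omega⟩ : Fin (l + m + 1)) (Fin.natAdd l i)).symm.trans ?_
    refine congrArg (moveLast _) (Fin.ext ?_)
    rw [Fin.succAbove_of_le_castSucc _ _ (Fin.le_def.2 (by simp))]
    exact Nat.add_right_comm _ _ _

theorem tr_last_cast {k k' l l' : ℕ} (hk : k' = k + 1) (hl : l' = l + 1) (j : Fin (l + 1))
    (p : P.carrier k' l') :
    P.tr (Fin.last k) j (P.cast hk hl p) =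
      P.tr (Fin.last k) (Fin.last l)
        (P.finMap (finCongr hk) ((finCongr hl).trans (moveLast j)) p) := by
  rw [P.cast_eq_finMap, tr_last_eq, P.finMap_finMap]
  rfl

/-- Each step of `iterTr` joins the last of the connected entries to the last of the connected
exits. The latter precede the `m` free exits, so the exit must first be moved to the end;
`transport_move` computes that renaming. -/
theorem iterTr_eq {k l m : ℕ} (p : P.Lab (Fin k ⊕ Fin l) (Fin l ⊕ Fin m)) :
    P.iterTr k m l p = P.trFin l (P.relabel (Equiv.refl _) (Equiv.sumComm _ _) p) := by
  induction l with
  | zero =>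
    rw [trFin, P.relabel_relabel]
    refine (P.relabel_eq_of_transport (A := Fin k ⊕ Fin 0) (B := Fin 0 ⊕ Fin m) (A' := Fin k)
      (B' := Fin m) (Nat.add_zero k)
      (Nat.zero_add m) transport_sumEmpty ?_ _).symm
    refine transport_eq ?_
    rintro (x | x)
    · exact x.elim0
    · exact Fin.ext (Nat.zero_add _).symm
  | succ l ih =>
    refine (ih _).trans ?_
    rw [trFin, P.relabel_relabel]
    refine congrArg (P.trFin l) ?_
    have h : P.tr (Fin.last (k + l)) ⟨l, by omega⟩ (P.cast (Nat.add_assoc k l 1).symm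
        (Nat.add_right_comm l 1 m) p) = P.trOne (A := Fin k ⊕ Fin l) (B := Fin l ⊕ Fin m)
        (P.relabel (splitLast (Fin k) l)
          (((Equiv.sumComm (Fin (l + 1)) (Fin m)).trans (splitLast (Fin m) l)).trans
            (Equiv.sumCongr (Equiv.sumComm _ _) (Equiv.refl _))) p) := by
      simp only [SymmModule.relabel, transport_move, transport_splitLast]
      exact P.tr_last_cast _ _ _ _
    refine (congrArg (P.relabel (A := Fin k ⊕ Fin l) (B := Fin l ⊕ Fin m)
      (Equiv.refl _) (Equiv.sumComm _ _)) h).trans ?_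
    rw [← trOne_relabel, P.relabel_relabel]
    congr 2
    · ext x
      simp
    · ext x
      simp

theorem vcomp_eq_comp {k l m : ℕ} (q : P.Lab (Fin l) (Fin m)) (p : P.Lab (Fin k) (Fin l)) :
    P.vcomp q p = P.comp q p := by
  refine (P.iterTr_eq _).trans ?_
  rw [comp, trace, P.relabel_relabel]
  refine congrArg (P.trFin l) ?_
  congr 1 <;> ext (x | x) <;> rfl

end TraP

theorem permTensor_one {m n : ℕ} :
    permTensor (1 : Equiv.Perm (Fin m)) (1 : Equiv.Perm (Fin n)) = 1 := by
  apply Equiv.ext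
  refine Fin.addCases (fun i => ?_) (fun i => ?_)
  · rw [permTensor_castAdd]; rfl
  · rw [permTensor_natAdd]; rfl

theorem mainTheorem10 {K : Type u} [Field K] (P : TraP.{u, v} K) :
    IsProP P.toConcatModule P.vcomp P.unit₁ := by
  -- Since `Lab (Fin k) (Fin l)` is `carrier k l` by definition, these three identities translate
  -- the remaining laws to the labelled setting.
  have hv {k l m : ℕ} (q : P.carrier l m) (p : P.carrier k l) : P.vcomp q p =
      P.comp (B := Fin l) (D := Fin m) (A := Fin k) q p := P.vcomp_eq_comp q p
  have hl {k l : ℕ} (σ : Equiv.Perm (Fin l)) (p : P.carrier k l) : P.lact σ p =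
      P.relabel (A := Fin k) (B := Fin l) (Equiv.refl _) σ p := P.lact_eq_finMap σ p
  have hr {k l : ℕ} (τ : Equiv.Perm (Fin k)) (p : P.carrier k l) : P.ract τ p =
      P.relabel (A := Fin k) (B := Fin l) τ.symm (Equiv.refl _) p := P.ract_eq_finMap τ p
  constructor
  case hmul_assoc => exact P.hmul_assoc
  case unit₀_hmul => exact P.unit₀_hmul
  case hmul_unit₀ => exact P.hmul_unit₀
  case hmul_comm => exact P.hmul_comm
  case comp_assoc =>
    intro k l m n p q r
    exact (congrArg (P.vcomp p) (hv q r)).trans ((hv p _).trans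
      ((P.comp_assoc (A := Fin k) (B := Fin l) (C := Fin m) (D := Fin n) p q r).trans
        ((hv _ r).symm.trans (congrArg (fun x => P.vcomp x r) (hv p q).symm))))
  case comp_unit =>
    intro k l p
    rw [hv]
    exact (P.yanks_hpow k).comp_unit _
  case unit_comp =>
    intro k l p
    rw [hv]
    exact (P.yanks_hpow l).unit_comp _
  case interchange =>
    intro k k' l l' m m' p p' q q'
    have h := P.mul_comp_mul (B := Fin l) (D := Fin m) (A := Fin k) (B' := Fin l') (C := Fin m')
      (A' := Fin k') p p' q q'
    -- The labelled products live over sums `Fin _ ⊕ Fin _`; `finSumFinEquiv` preserves numbers, so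
    -- this renaming changes the label types but not the elements.
    have h' := congrArg (P.relabel finSumFinEquiv finSumFinEquiv) h
    rw [← P.comp_relabel_relabel finSumFinEquiv] at h'
    simp only [P.relabel_finSumFinEquiv] at h'
    rw [hv p q, hv p' q', hv]
    exact h'
  case lact_comp =>
    intro k l m σ p q
    exact (congrArg _ (hv p q)).trans ((hl _ _).trans
      ((P.relabel_comp (A := Fin k) (B := Fin l) (D := Fin m) σ p q).trans
        ((hv _ q).symm.trans (congrArg (fun x => P.vcomp x q) (hl σ p).symm))))
  case ract_comp =>
    intro k l m τ p q
    exact (congrArg _ (hv p q)).trans ((hr _ _).trans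
      ((P.comp_relabel (A := Fin k) (B := Fin l) (D := Fin m) τ.symm p q).trans
        ((hv p _).symm.trans (congrArg (P.vcomp p) (hr τ q).symm))))
  case comp_balanced =>
    intro k l m τ p q
    exact (congrArg (fun x => P.vcomp x q) (hr τ p)).trans ((hv _ q).trans
      ((P.comp_slide (A := Fin k) (B := Fin l) (D := Fin m) τ p q).trans
        ((hv p _).symm.trans (congrArg (P.vcomp p) (hl τ q).symm))))
  case hmul_lact =>
    intro k l k' l' σ σ' p p'
    have h := P.hmul_act σ 1 σ' 1 p p'
    simpa only [permTensor_one, P.one_ract] using h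
  case hmul_ract =>
    intro k l k' l' τ τ' p p'
    have h := P.hmul_act 1 τ 1 τ' p p'
    simpa only [permTensor_one, P.one_lact] using h
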